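/- For $a\in\mathbb{C}$ and $k\ge 0$ let $(a)_k=a(a+1)\cdots(a+k-1)$. Let $a,b_1,b_2,c_1,c_2\in\mathbb{C}$ satisfy $$\Re a,\ \Re(a-b_2),\ \Re(b_2+c_1-a),\ \Re(b_2-c_2+1),\ \Re(c_1+c_2-a-1)>0 .$$ Then the following holds. (i) Olsson's double power series $$F_P(a,b_1,b_2,c_1,c_2;x,y)=\sum_{i,j=0}^{\infty}\frac{(a)_{i+j}(a-c_2+1)_i(b_1)_i(b_2)_j}{(a+b_2-c_2+1)_{i+j}(c_1)_i\,i!\,j!}\,x^i(1-y)^j$$ converges absolutely for $|x|<1$, $|y-1|<1$, and its sum continues analytically to the set of all $(x,y)\in\mathbb{C}^2$ with $x\notin[1,\infty)$ and $y\notin(-\infty,0]$. (ii) Appell's double power series $$F_1(a;b_1,b_2;b_2+c_1;x,z)=\sum_{i,j=0}^{\infty}\frac{(a)_{i+j}(b_1)_i(b_2)_j}{(b_2+c_1)_{i+j}\,i!\,j!}\,x^iz^j$$ converges absolutely for $|x|<1$, $|z|<1$, and its sum continues analytically to the set of all $(x,z)\in\mathbb{C}^2$ with $x\notin[1,\infty)$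 and $z\notin[1,\infty)$. (iii) Denote the continued functions again by $F_P$ and $F_1$. For all $(x,y)\in\mathbb{C}^2$ with $x\notin[1,\infty)$ and $y\notin(-\infty,0]$, $$F_P(a,b_1,b_2,c_1,c_2;x,y)=\frac{\Gamma(a+b_2-c_2+1)\,\Gamma(c_1)\,\Gamma(b_2+c_1-a)}{\Gamma(b_2+c_1)\,\Gamma(a-c_2+1)\,\Gamma(b_2-c_2+1)\,\Gamma(c_1+c_2-a-1)}\int_0^1 v^{-c_2}(1-v)^{c_1+c_2-a-2}\,F_1\!\left(a;b_1,b_2;b_2+c_1;x,\frac{v-y}{v}\right)dv,$$ where the integral converges absolutely and the powers of $v$ and $1-v$ are principal. -/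

import Mathlib

/-- The Pochhammer symbol `(a)_k = a (a + 1) ⋯ (a + k - 1)` for `k : ℕ`. -/
noncomputable def poch (a : ℂ) (k : ℕ) : ℂ := (ascPochhammer ℂ k).eval a

/-- `f` is a holomorphic function on `D` which agrees with `g` on `U`. -/
def IsAnalyticContinuation (g : ℂ × ℂ → ℂ) (U D : Set (ℂ × ℂ)) (f : ℂ × ℂ → ℂ) : Prop :=
  DifferentiableOn ℂ f D ∧ Set.EqOn f g U

open Classical in
/-- The analytic continuation of `g` from `U` to `D`. It is used only for nonempty open `U ⊆ D` with
`D` open and connected, where its values on `D` are unique by the identity theorem. -/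
noncomputable def analyticContinuation (g : ℂ × ℂ → ℂ) (U D : Set (ℂ × ℂ)) : ℂ × ℂ → ℂ :=
  if h : ∃ f, IsAnalyticContinuation g U D f then Classical.choose h else 0

/-- The double power series of the Appell function `F₁(a; b, b'; c; x, z)`,
absolutely convergent for `|x| < 1`, `|z| < 1`. -/
noncomputable def appellF1Series (a b b' c : ℂ) (p : ℂ × ℂ) : ℂ :=
  ∑' n : ℕ × ℕ,
    poch a (n.1 + n.2) * poch b n.1 * poch b' n.2 /
      (poch c (n.1 + n.2) * (n.1.factorial : ℂ) * (n.2.factorial : ℂ)) *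
      p.1 ^ n.1 * p.2 ^ n.2

/-- The polydisc `|x| < 1`, `|z| < 1`. -/
def appellF1Disc : Set (ℂ × ℂ) := {p | ‖p.1‖ < 1 ∧ ‖p.2‖ < 1}

/-- The set of `(x, z)` with `x ∉ [1, ∞)` and `z ∉ [1, ∞)`. -/
def appellF1Domain : Set (ℂ × ℂ) :=
  {p | 1 - p.1 ∈ Complex.slitPlane ∧ 1 - p.2 ∈ Complex.slitPlane}

/-- The Appell function `F₁(a; b, b'; c; x, z)`, continued analytically to
`x, z ∉ [1, ∞)`. -/
noncomputable def appellF1 (a b b' c : ℂ) (x z : ℂ) : ℂ :=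
  analyticContinuation (appellF1Series a b b' c) appellF1Disc appellF1Domain (x, z)

/-- The double power series of Olsson's function `F_P(a, b₁, b₂, c₁, c₂; x, y)`,
absolutely convergent for `|x| < 1`, `|y - 1| < 1`. -/
noncomputable def olssonFPSeries (a b₁ b₂ c₁ c₂ : ℂ) (p : ℂ × ℂ) : ℂ :=
  ∑' n : ℕ × ℕ,
    poch a (n.1 + n.2) * poch (a - c₂ + 1) n.1 * poch b₁ n.1 * poch b₂ n.2 /
      (poch (a + b₂ - c₂ + 1) (n.1 + n.2) * poch c₁ n.1 *
        (n.1.factorial : ℂ) * (n.2.factorial : ℂ)) *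
      p.1 ^ n.1 * (1 - p.2) ^ n.2

/-- The polydisc `|x| < 1`, `|y - 1| < 1`. -/
def olssonFPDisc : Set (ℂ × ℂ) := {p | ‖p.1‖ < 1 ∧ ‖p.2 - 1‖ < 1}

/-- The set of `(x, y)` with `x ∉ [1, ∞)` and `y ∉ (-∞, 0]`. -/
def olssonFPDomain : Set (ℂ × ℂ) :=
  {p | 1 - p.1 ∈ Complex.slitPlane ∧ p.2 ∈ Complex.slitPlane}

/-- Olsson's function `F_P(a, b₁, b₂, c₁, c₂; x, y)`, continued analytically to
`x ∉ [1, ∞)`, `y ∉ (-∞, 0]`. -/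
noncomputable def olssonFP (a b₁ b₂ c₁ c₂ : ℂ) (x y : ℂ) : ℂ :=
  analyticContinuation (olssonFPSeries a b₁ b₂ c₁ c₂) olssonFPDisc olssonFPDomain (x, y)

/-! Both functions are Euler integrals. Expanding binomial powers under a beta weight gives F₁ =
B(a, c-a)⁻¹ ∫ u^(a-1) (1-u)^(c-a-1) (1-ux)^(-b₁) (1-uz)^(-b₂) du with c = b₂+c₁. Likewise F_P is a
normalised integral over the unit square of t^(a-1) (1-t)^(b₂-c₂) s^(a-c₂) (1-s)^(c₁+c₂-a-2)
(1-tsx)^(-b₁) (1-t(1-y))^(-b₂). These integrals converge and are holomorphic on the slit domains, so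
they are the continuations; uniqueness holds because the domains are star convex.

Inserting the F₁ integral on the right-hand side gives a double integral in (u, v). The substitution
u = ts, 1-s = (1-u)(1-v) maps the unit square bijectively to itself and turns this integrand into
that of F_P: all powers of 1-ts, including the one from the Jacobian, cancel
(`appellIntegrand_olssonSubst`). The same substitution transfers integrability, so Fubini applies,
and the constant is a quotient of beta values. -/

open MeasureTheory

/-! ### Uniqueness of analytic continuation -/

/-- `D` star convex about `c`, `f` and `g` holomorphic on `D` and equal near `c`: equal on `D`. -/
theorem DifferentiableOn.eqOn_of_starConvex_of_eventuallyEq {E : Type*} [NormedAddCommGroup E]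
    [NormedSpace ℂ E] {f g : E → ℂ} {D : Set E} {c : E} (hD : IsOpen D)
    (hc : c ∈ D) (hstar : StarConvex ℝ c D) (hf : DifferentiableOn ℂ f D)
    (hg : DifferentiableOn ℂ g D) (hfg : f =ᶠ[nhds c] g) : Set.EqOn f g D := by
  intro p hp
  -- Restrict to the complex line through `c` and `p`. The preimage of `D` is star convex about 0,
  -- hence connected, and contains 0 and 1, so the one-variable identity theorem carries equality
  -- from `c` to `p`.
  let ℓ : ℂ → E := fun t => c + t • (p - c)
  have hℓ : Differentiable ℂ ℓ := by fun_prop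
  have hTo : IsOpen (ℓ ⁻¹' D) := hD.preimage hℓ.continuous
  have hstarT : StarConvex ℝ (0 : ℂ) (ℓ ⁻¹' D) := by
    intro t ht u v hu hv huv
    have := hstar ht hu hv huv
    convert this using 1
    simp only [ℓ, Set.mem_preimage]
    have : u • c + v • (c + t • (p - c)) = c + (v : ℂ) • t • (p - c) := by
      rw [smul_add, ← add_assoc, ← add_smul, huv, one_smul, Complex.coe_smul]
    rw [this]
    simp [smul_smul]
  have h0 : (0 : ℂ) ∈ ℓ ⁻¹' D := by simpa [ℓ] using hc
  have h1 : (1 : ℂ) ∈ ℓ ⁻¹' D := by simpa [ℓ] using hp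
  have hpre : IsPreconnected (ℓ ⁻¹' D) :=
    (hstarT.isPathConnected h0).isConnected.isPreconnected
  have hfa := (hf.comp hℓ.differentiableOn (Set.mapsTo_preimage ℓ D)).analyticOnNhd hTo
  have hga := (hg.comp hℓ.differentiableOn (Set.mapsTo_preimage ℓ D)).analyticOnNhd hTo
  have hev : f ∘ ℓ =ᶠ[nhds 0] g ∘ ℓ := by
    have ht : Filter.Tendsto ℓ (nhds 0) (nhds c) := by
      have := hℓ.continuous.tendsto 0
      simpa [ℓ] using this
    exact ht.eventually hfg
  have := hfa.eqOn_of_preconnected_of_eventuallyEq hga hpre h0 hev h1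
  simpa [ℓ] using this

theorem analyticContinuation_spec {g f : ℂ × ℂ → ℂ} {U D : Set (ℂ × ℂ)}
    (hf : IsAnalyticContinuation g U D f) :
    IsAnalyticContinuation g U D (analyticContinuation g U D) := by
  have h : ∃ f, IsAnalyticContinuation g U D f := ⟨f, hf⟩
  rw [analyticContinuation, dif_pos h]
  exact Classical.choose_spec h

theorem IsAnalyticContinuation.eqOn {g f : ℂ × ℂ → ℂ} {U D : Set (ℂ × ℂ)} {c : ℂ × ℂ}
    (hf : IsAnalyticContinuation g U D f) (hD : IsOpen D) (hc : c ∈ D) (hU : U ∈ nhds c)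
    (hstar : StarConvex ℝ c D) : Set.EqOn (analyticContinuation g U D) f D := by
  have h := analyticContinuation_spec hf
  refine DifferentiableOn.eqOn_of_starConvex_of_eventuallyEq hD hc hstar h.1 hf.1 ?_
  filter_upwards [hU] with p hp
  rw [h.2 hp, hf.2 hp]

/-! ### Binomial series and Euler transforms -/

theorem hasSum_mul_prod {f g : ℕ → ℂ} {s t : ℂ} (hf : HasSum f s) (hg : HasSum g t) :
    HasSum (fun n : ℕ × ℕ => f n.1 * g n.2) (s * t) :=
  hf.mul hg (summable_mul_of_summable_norm hf.summable.norm hg.summable.norm)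

theorem hasSum_poch_div_factorial_mul_pow (b : ℂ) {x : ℂ} (hx : ‖x‖ < 1) :
    HasSum (fun n : ℕ => poch b n / (n.factorial : ℂ) * x ^ n) ((1 - x) ^ (-b)) := by
  have h := (Complex.one_div_one_sub_cpow_hasFPowerSeriesOnBall_zero b).hasSum (y := x)
    (by rw [mem_eball_zero_iff, ← ofReal_norm]; exact ENNReal.ofReal_lt_one.2 hx)
  simp only [zero_add, one_div, ← Complex.cpow_neg] at h
  convert! h using 1
  funext n
  have hn : (n.factorial : ℂ) ≠ 0 := by exact_mod_cast n.factorial_ne_zero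
  have := Ring.factorial_nsmul_multichoose_eq_ascPochhammer b n
  rw [Ring.multichoose_eq, Polynomial.ascPochhammer_smeval_eq_eval, nsmul_eq_mul] at this
  simp only [FormalMultilinearSeries.ofScalars_apply_eq, smul_eq_mul]
  rw [poch, ← this]
  field_simp

/-- The point lies on the segment from 1 to 1 - x, and the slit plane is star convex about 1. This
keeps the principal powers in the Euler kernels holomorphic on the whole domain. -/
theorem one_sub_ofReal_mul_mem_slitPlane {m : ℝ} {x : ℂ} (hm : m ∈ Set.Icc (0 : ℝ) 1)
    (hx : 1 - x ∈ Complex.slitPlane) : 1 - (m : ℂ) * x ∈ Complex.slitPlane := by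
  have := Complex.starConvex_one_slitPlane hx (sub_nonneg.2 hm.2) hm.1 (by ring)
  convert this using 1
  simp only [Complex.real_smul]
  push_cast
  ring

section EulerTransform

variable {Ω : Type*} [MeasurableSpace Ω]

/-- The double Euler transform `∫ w (1 - m₁ x)^(-b₁) (1 - m₂ z)^(-b₂) dμ` of a weight `w`. -/
noncomputable def eulerTransform (μ : Measure Ω) (w : Ω → ℂ) (m₁ m₂ : Ω → ℝ) (b₁ b₂ : ℂ)
    (p : ℂ × ℂ) : ℂ :=
  ∫ ω, w ω * ((1 - (m₁ ω : ℂ) * p.1) ^ (-b₁) * (1 - (m₂ ω : ℂ) * p.2) ^ (-b₂)) ∂μ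

theorem isOpen_appellF1Domain : IsOpen appellF1Domain :=
  (Complex.isOpen_slitPlane.preimage (by fun_prop : Continuous fun p : ℂ × ℂ => 1 - p.1)).inter
    (Complex.isOpen_slitPlane.preimage (by fun_prop : Continuous fun p : ℂ × ℂ => 1 - p.2))

theorem exists_bound_of_continuousOn_unitInterval {F : Type*} [NormedAddCommGroup F]
    {k : ℝ × ℝ × (ℂ × ℂ) → F} {B : Set (ℂ × ℂ)} (hB : IsCompact B)
    (hk : ContinuousOn k (Set.Icc 0 1 ×ˢ Set.Icc 0 1 ×ˢ B)) :
    ∃ C, ∀ m₁ ∈ Set.Icc (0 : ℝ) 1, ∀ m₂ ∈ Set.Icc (0 : ℝ) 1, ∀ p ∈ B, ‖k (m₁, m₂, p)‖ ≤ C := by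
  obtain ⟨C, hC⟩ := (isCompact_Icc.prod (isCompact_Icc.prod hB)).exists_bound_of_continuousOn hk
  exact ⟨C, fun m₁ h₁ m₂ h₂ p hp => hC _ ⟨h₁, h₂, hp⟩⟩

theorem continuousOn_eulerKernel_left (b : ℂ) {B : Set (ℂ × ℂ)} (hB : B ⊆ appellF1Domain) :
    ContinuousOn (fun q : ℝ × ℝ × (ℂ × ℂ) => (1 - (q.1 : ℂ) * q.2.2.1) ^ b)
      (Set.Icc 0 1 ×ˢ Set.Icc 0 1 ×ˢ B) := by
  refine ContinuousOn.cpow (by fun_prop) continuousOn_const fun q hq => ?_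
  exact one_sub_ofReal_mul_mem_slitPlane hq.1 (hB hq.2.2).1

theorem continuousOn_eulerKernel_right (b : ℂ) {B : Set (ℂ × ℂ)} (hB : B ⊆ appellF1Domain) :
    ContinuousOn (fun q : ℝ × ℝ × (ℂ × ℂ) => (1 - (q.2.1 : ℂ) * q.2.2.2) ^ b)
      (Set.Icc 0 1 ×ˢ Set.Icc 0 1 ×ˢ B) := by
  refine ContinuousOn.cpow (by fun_prop) continuousOn_const fun q hq => ?_
  exact one_sub_ofReal_mul_mem_slitPlane hq.2.1 (hB hq.2.2).2

variable {μ : Measure Ω} {w : Ω → ℂ} {m₁ m₂ : Ω → ℝ}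

theorem integrable_eulerKernel (hw : Integrable w μ) (hm₁ : Measurable m₁) (hm₂ : Measurable m₂)
    (h₁ : ∀ᵐ ω ∂μ, m₁ ω ∈ Set.Icc (0 : ℝ) 1) (h₂ : ∀ᵐ ω ∂μ, m₂ ω ∈ Set.Icc (0 : ℝ) 1)
    (b₁ b₂ : ℂ) {p : ℂ × ℂ} (hp : p ∈ appellF1Domain) :
    Integrable (fun ω => w ω * ((1 - (m₁ ω : ℂ) * p.1) ^ (-b₁) *
      (1 - (m₂ ω : ℂ) * p.2) ^ (-b₂))) μ := by
  have hsub : {p} ⊆ appellF1Domain := by simpa using hp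
  obtain ⟨C, hC⟩ := exists_bound_of_continuousOn_unitInterval isCompact_singleton
    ((continuousOn_eulerKernel_left (-b₁) hsub).mul (continuousOn_eulerKernel_right (-b₂) hsub))
  refine hw.mul_bdd (c := C) (Measurable.aestronglyMeasurable (by fun_prop)) ?_
  filter_upwards [h₁, h₂] with ω h₁ h₂
  exact hC _ h₁ _ h₂ p rfl

theorem differentiableOn_eulerTransform (hw : Integrable w μ) (hm₁ : Measurable m₁)
    (hm₂ : Measurable m₂) (h₁ : ∀ᵐ ω ∂μ, m₁ ω ∈ Set.Icc (0 : ℝ) 1)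
    (h₂ : ∀ᵐ ω ∂μ, m₂ ω ∈ Set.Icc (0 : ℝ) 1) (b₁ b₂ : ℂ) :
    DifferentiableOn ℂ (eulerTransform μ w m₁ m₂ b₁ b₂) appellF1Domain := by
  intro p₀ hp₀
  obtain ⟨ε, hε, hball⟩ := Metric.nhds_basis_closedBall.mem_iff.1
    (isOpen_appellF1Domain.mem_nhds hp₀)
  -- The derivative of the kernel in `p`, taken as a function of `(m₁, m₂, p)` jointly: continuity
  -- on a compact set then bounds it uniformly in `ω`, so a multiple of `‖w‖` dominates.
  let k' : ℝ × ℝ × (ℂ × ℂ) → (ℂ × ℂ →L[ℂ] ℂ) := fun q =>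
    ((1 - (q.1 : ℂ) * q.2.2.1) ^ (-b₁) * (b₂ * q.2.1 * (1 - (q.2.1 : ℂ) * q.2.2.2) ^ (-b₂ - 1))) •
      ContinuousLinearMap.snd ℂ ℂ ℂ +
    ((1 - (q.2.1 : ℂ) * q.2.2.2) ^ (-b₂) * (b₁ * q.1 * (1 - (q.1 : ℂ) * q.2.2.1) ^ (-b₁ - 1))) •
      ContinuousLinearMap.fst ℂ ℂ ℂ
  have hk' : ContinuousOn k' (Set.Icc 0 1 ×ˢ Set.Icc 0 1 ×ˢ Metric.closedBall p₀ ε) := by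
    have := continuousOn_eulerKernel_left (-b₁) hball
    have := continuousOn_eulerKernel_right (-b₂) hball
    have := continuousOn_eulerKernel_left (-b₁ - 1) hball
    have := continuousOn_eulerKernel_right (-b₂ - 1) hball
    fun_prop
  obtain ⟨C, hC⟩ := exists_bound_of_continuousOn_unitInterval (isCompact_closedBall p₀ ε) hk'
  have hderiv : ∀ᵐ ω ∂μ, ∀ p ∈ Metric.closedBall p₀ ε,
      HasFDerivAt (fun p : ℂ × ℂ => w ω * ((1 - (m₁ ω : ℂ) * p.1) ^ (-b₁) *
        (1 - (m₂ ω : ℂ) * p.2) ^ (-b₂))) (w ω • k' (m₁ ω, m₂ ω, p)) p := by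
    filter_upwards [h₁, h₂] with ω h₁ h₂ p hp
    have hs₁ := one_sub_ofReal_mul_mem_slitPlane h₁ (hball hp).1
    have hs₂ := one_sub_ofReal_mul_mem_slitPlane h₂ (hball hp).2
    have d₁ : HasFDerivAt (fun p : ℂ × ℂ => 1 - (m₁ ω : ℂ) * p.1)
        (-((m₁ ω : ℂ) • ContinuousLinearMap.fst ℂ ℂ ℂ)) p :=
      (hasFDerivAt_fst.const_mul _).const_sub 1
    have d₂ : HasFDerivAt (fun p : ℂ × ℂ => 1 - (m₂ ω : ℂ) * p.2)
        (-((m₂ ω : ℂ) • ContinuousLinearMap.snd ℂ ℂ ℂ)) p :=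
      (hasFDerivAt_snd.const_mul _).const_sub 1
    have k₁ := (Complex.hasStrictDerivAt_cpow_const (c := -b₁) hs₁).hasDerivAt.comp_hasFDerivAt p d₁
    have k₂ := (Complex.hasStrictDerivAt_cpow_const (c := -b₂) hs₂).hasDerivAt.comp_hasFDerivAt p d₂
    have := (k₁.mul k₂).const_mul (w ω)
    convert! this using 1
    simp only [k', Function.comp_apply]
    module
  refine (hasFDerivAt_integral_of_dominated_of_fderiv_le
    (F' := fun p ω => w ω • k' (m₁ ω, m₂ ω, p)) (bound := fun ω => ‖w ω‖ * C)
    (Metric.closedBall_mem_nhds p₀ hε) ?_ (integrable_eulerKernel hw hm₁ hm₂ h₁ h₂ b₁ b₂ hp₀)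
    ?_ ?_ (hw.norm.mul_const C) ?_).differentiableAt.differentiableWithinAt
  · filter_upwards [isOpen_appellF1Domain.mem_nhds hp₀] with p hp
    exact (integrable_eulerKernel hw hm₁ hm₂ h₁ h₂ b₁ b₂ hp).aestronglyMeasurable
  · refine hw.aestronglyMeasurable.smul (AEStronglyMeasurable.add ?_ ?_)
    · exact AEStronglyMeasurable.smul_const (Measurable.aestronglyMeasurable (by fun_prop)) _
    · exact AEStronglyMeasurable.smul_const (Measurable.aestronglyMeasurable (by fun_prop)) _
  · filter_upwards [h₁, h₂] with ω h₁ h₂ p hp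
    rw [norm_smul]
    exact mul_le_mul_of_nonneg_left (hC _ h₁ _ h₂ p hp) (norm_nonneg _)
  · exact hderiv

/-- Expand both powers in binomial series and integrate termwise. Since 0 ≤ m₁, m₂ ≤ 1, the
integrals of the norms of the terms are at most `‖c n‖ * ∫ ‖w‖`, which is summable. -/
theorem hasSum_eulerTransform (hw : Integrable w μ) (hm₁ : Measurable m₁)
    (hm₂ : Measurable m₂) (h₁ : ∀ᵐ ω ∂μ, m₁ ω ∈ Set.Icc (0 : ℝ) 1)
    (h₂ : ∀ᵐ ω ∂μ, m₂ ω ∈ Set.Icc (0 : ℝ) 1) (b₁ b₂ : ℂ) {p : ℂ × ℂ} (hp : p ∈ appellF1Disc) :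
    HasSum (fun n : ℕ × ℕ => (poch b₁ n.1 / (n.1.factorial : ℂ) * p.1 ^ n.1) *
        (poch b₂ n.2 / (n.2.factorial : ℂ) * p.2 ^ n.2) *
        ∫ ω, w ω * ((m₁ ω : ℂ) ^ n.1 * (m₂ ω : ℂ) ^ n.2) ∂μ)
      (eulerTransform μ w m₁ m₂ b₁ b₂ p) := by
  let c : ℕ × ℕ → ℂ := fun n => (poch b₁ n.1 / (n.1.factorial : ℂ) * p.1 ^ n.1) *
        (poch b₂ n.2 / (n.2.factorial : ℂ) * p.2 ^ n.2)
  have hc : Summable fun n => ‖c n‖ :=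
    (hasSum_mul_prod (hasSum_poch_div_factorial_mul_pow b₁ hp.1)
      (hasSum_poch_div_factorial_mul_pow b₂ hp.2)).summable.norm
  have hle : ∀ n : ℕ × ℕ, ∀ᵐ ω ∂μ, ‖(m₁ ω : ℂ) ^ n.1 * (m₂ ω : ℂ) ^ n.2‖ ≤ 1 := by
    intro n
    filter_upwards [h₁, h₂] with ω h₁ h₂
    rw [norm_mul, norm_pow, norm_pow, Complex.norm_real, Complex.norm_real, Real.norm_of_nonneg h₁.1,
      Real.norm_of_nonneg h₂.1]
    exact mul_le_one₀ (pow_le_one₀ h₁.1 h₁.2) (pow_nonneg h₂.1 _) (pow_le_one₀ h₂.1 h₂.2)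
  have hint : ∀ n : ℕ × ℕ, Integrable (fun ω => w ω * ((m₁ ω : ℂ) ^ n.1 * (m₂ ω : ℂ) ^ n.2)) μ :=
    fun n => hw.mul_bdd (Measurable.aestronglyMeasurable (by fun_prop)) (hle n)
  have key := hasSum_integral_of_summable_integral_norm (μ := μ)
    (F := fun n ω => c n * (w ω * ((m₁ ω : ℂ) ^ n.1 * (m₂ ω : ℂ) ^ n.2)))
    (fun n => (hint n).const_mul (c n)) ?_
  · simp only [integral_const_mul] at key
    convert! key using 1
    refine integral_congr_ae ?_
    filter_upwards [h₁, h₂] with ω h₁ h₂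
    have hx : ‖(m₁ ω : ℂ) * p.1‖ < 1 := by
      rw [norm_mul, Complex.norm_real, Real.norm_of_nonneg h₁.1]
      exact mul_lt_one_of_nonneg_of_lt_one_right h₁.2 (norm_nonneg _) hp.1
    have hz : ‖(m₂ ω : ℂ) * p.2‖ < 1 := by
      rw [norm_mul, Complex.norm_real, Real.norm_of_nonneg h₂.1]
      exact mul_lt_one_of_nonneg_of_lt_one_right h₂.2 (norm_nonneg _) hp.2
    have s₁ := hasSum_poch_div_factorial_mul_pow b₁ hx
    have s₂ := hasSum_poch_div_factorial_mul_pow b₂ hz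
    have := (hasSum_mul_prod s₁ s₂).mul_left (w ω)
    rw [← this.tsum_eq]
    refine tsum_congr fun n => ?_
    simp only [c, mul_pow]
    ring
  · refine Summable.of_nonneg_of_le (fun n => integral_nonneg fun _ => norm_nonneg _) (fun n => ?_)
      (hc.mul_right (∫ ω, ‖w ω‖ ∂μ))
    rw [← integral_const_mul]
    refine integral_mono_ae ((hint n).const_mul _).norm (hw.norm.const_mul _) ?_
    filter_upwards [hle n] with ω h
    rw [norm_mul (c n), norm_mul (w ω)]
    refine mul_le_mul_of_nonneg_left ?_ (norm_nonneg (c n))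
    exact mul_le_of_le_one_right (norm_nonneg _) h

end EulerTransform

/-! ### Moments of the beta weight -/

/-- The weight `t ^ (u - 1) * (1 - t) ^ (v - 1)` of the beta integral. -/
noncomputable def betaWeight (u v : ℂ) (t : ℝ) : ℂ := (t : ℂ) ^ (u - 1) * (1 - (t : ℂ)) ^ (v - 1)

theorem integrableOn_betaWeight {u v : ℂ} (hu : 0 < u.re) (hv : 0 < v.re) :
    IntegrableOn (betaWeight u v) (Set.Ioo 0 1) :=
  ((intervalIntegrable_iff_integrableOn_Ioo_of_le zero_le_one).1
    (Complex.betaIntegral_convergent hu hv) :)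

theorem setIntegral_betaWeight (u v : ℂ) :
    ∫ t in Set.Ioo (0 : ℝ) 1, betaWeight u v t = Complex.betaIntegral u v := by
  rw [Complex.betaIntegral, intervalIntegral.integral_of_le zero_le_one, integral_Ioc_eq_integral_Ioo]
  rfl

theorem ne_neg_natCast_of_re_pos {z : ℂ} (hz : 0 < z.re) (m : ℕ) : z ≠ -m := by
  rintro rfl
  simp at hz
  linarith [(Nat.cast_nonneg m : (0 : ℝ) ≤ m)]

theorem Gamma_add_natCast_eq_poch_mul {z : ℂ} (hz : 0 < z.re) (n : ℕ) :
    Complex.Gamma (z + n) = poch z n * Complex.Gamma z := by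
  have h := Complex.Gamma_ne_zero_of_re_pos hz
  rw [poch, ← Complex.Gamma_add_nat_div_Gamma_eq z (ne_neg_natCast_of_re_pos hz), div_mul_cancel₀ _ h]

theorem poch_ne_zero {z : ℂ} (hz : 0 < z.re) (n : ℕ) : poch z n ≠ 0 := by
  intro h
  have := Gamma_add_natCast_eq_poch_mul hz n
  rw [h, zero_mul] at this
  refine Complex.Gamma_ne_zero_of_re_pos ?_ this
  simp
  positivity

theorem betaIntegral_eq_Gamma_mul_div {u v : ℂ} (hu : 0 < u.re) (hv : 0 < v.re) :
    Complex.betaIntegral u v = Complex.Gamma u * Complex.Gamma v / Complex.Gamma (u + v) := by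
  have huv : 0 < (u + v).re := by simpa using add_pos hu hv
  rw [Complex.Gamma_mul_Gamma_eq_betaIntegral hu hv,
    mul_div_cancel_left₀ _ (Complex.Gamma_ne_zero_of_re_pos huv)]

theorem betaIntegral_ne_zero {u v : ℂ} (hu : 0 < u.re) (hv : 0 < v.re) :
    Complex.betaIntegral u v ≠ 0 := by
  have huv : 0 < (u + v).re := by simpa using add_pos hu hv
  rw [betaIntegral_eq_Gamma_mul_div hu hv]
  exact div_ne_zero (mul_ne_zero (Complex.Gamma_ne_zero_of_re_pos hu)
    (Complex.Gamma_ne_zero_of_re_pos hv)) (Complex.Gamma_ne_zero_of_re_pos huv)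

/-- The factor t^n only shifts u to u + n; the functional equation of Γ then yields the Pochhammer
quotient. -/
theorem setIntegral_betaWeight_mul_pow {u v : ℂ} (hu : 0 < u.re) (hv : 0 < v.re) (n : ℕ) :
    ∫ t in Set.Ioo (0 : ℝ) 1, betaWeight u v t * (t : ℂ) ^ n =
      Complex.betaIntegral u v * (poch u n / poch (u + v) n) := by
  have huv : 0 < (u + v).re := by simpa using add_pos hu hv
  have hun : 0 < (u + n).re := by simp; positivity
  have : ∫ t in Set.Ioo (0 : ℝ) 1, betaWeight u v t * (t : ℂ) ^ n =
      ∫ t in Set.Ioo (0 : ℝ) 1, betaWeight (u + n) v t := by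
    refine setIntegral_congr_fun measurableSet_Ioo fun t ht => ?_
    have ht0 : (t : ℂ) ≠ 0 := by exact_mod_cast ht.1.ne'
    simp only [betaWeight]
    rw [add_sub_right_comm, Complex.cpow_add _ _ ht0, Complex.cpow_natCast]
    ring
  rw [this, setIntegral_betaWeight, betaIntegral_eq_Gamma_mul_div hun hv,
    betaIntegral_eq_Gamma_mul_div hu hv, add_right_comm, Gamma_add_natCast_eq_poch_mul hu,
    Gamma_add_natCast_eq_poch_mul huv]
  have := Complex.Gamma_ne_zero_of_re_pos huv
  have := poch_ne_zero huv n
  field_simp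

/-! ### Geometry of the two domains, related by y ↦ 1 - y -/

theorem starConvex_appellF1Domain : StarConvex ℝ (0 : ℂ × ℂ) appellF1Domain := by
  intro p hp u v hu hv huv
  obtain rfl : u = 1 - v := by linarith
  have hv1 : v ≤ 1 := by linarith
  constructor
  · simpa using one_sub_ofReal_mul_mem_slitPlane ⟨hv, hv1⟩ hp.1
  · simpa using one_sub_ofReal_mul_mem_slitPlane ⟨hv, hv1⟩ hp.2

theorem zero_mem_appellF1Domain : (0 : ℂ × ℂ) ∈ appellF1Domain := by
  simp [appellF1Domain]

theorem appellF1Disc_mem_nhds : appellF1Disc ∈ nhds (0 : ℂ × ℂ) :=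
  ((isOpen_lt (by fun_prop) continuous_const).inter
    (isOpen_lt (by fun_prop) continuous_const) : IsOpen ({p : ℂ × ℂ | ‖p.1‖ < 1} ∩
      {p : ℂ × ℂ | ‖p.2‖ < 1})).mem_nhds (by simp)

theorem olssonFPDomain_eq_preimage :
    olssonFPDomain = (fun p : ℂ × ℂ => (p.1, 1 - p.2)) ⁻¹' appellF1Domain := by
  ext p
  simp [olssonFPDomain, appellF1Domain]

theorem olssonFPDisc_eq_preimage :
    olssonFPDisc = (fun p : ℂ × ℂ => (p.1, 1 - p.2)) ⁻¹' appellF1Disc := by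
  ext p
  simp [olssonFPDisc, appellF1Disc, norm_sub_rev]

theorem isOpen_olssonFPDomain : IsOpen olssonFPDomain := by
  rw [olssonFPDomain_eq_preimage]
  exact isOpen_appellF1Domain.preimage (by fun_prop)

theorem starConvex_olssonFPDomain : StarConvex ℝ ((0, 1) : ℂ × ℂ) olssonFPDomain := by
  intro p hp u v hu hv huv
  rw [olssonFPDomain_eq_preimage] at hp ⊢
  have h := starConvex_appellF1Domain hp hu hv huv
  obtain rfl : u = 1 - v := by linarith
  rw [Set.mem_preimage]
  convert! h using 1
  ext <;> simp
  ring

theorem mem_olssonFPDomain : ((0, 1) : ℂ × ℂ) ∈ olssonFPDomain := by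
  simp [olssonFPDomain]

theorem olssonFPDisc_mem_nhds : olssonFPDisc ∈ nhds ((0, 1) : ℂ × ℂ) := by
  rw [olssonFPDisc_eq_preimage]
  refine ContinuousAt.preimage_mem_nhds (by fun_prop) ?_
  simpa [Prod.mk_zero_zero] using appellF1Disc_mem_nhds

/-! ### Euler integral of Appell's function -/

section AppellF1

variable {a b₁ b₂ c : ℂ}

theorem hasSum_appellF1 (ha : 0 < a.re) (hc : 0 < (c - a).re) {p : ℂ × ℂ} (hp : p ∈ appellF1Disc) :
    HasSum (fun n : ℕ × ℕ => poch a (n.1 + n.2) * poch b₁ n.1 * poch b₂ n.2 /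
      (poch c (n.1 + n.2) * (n.1.factorial : ℂ) * (n.2.factorial : ℂ)) * p.1 ^ n.1 * p.2 ^ n.2)
      ((Complex.betaIntegral a (c - a))⁻¹ * eulerTransform (volume.restrict (Set.Ioo 0 1))
        (betaWeight a (c - a)) id id b₁ b₂ p) := by
  have hm : ∀ᵐ t ∂(volume.restrict (Set.Ioo (0 : ℝ) 1)), id t ∈ Set.Icc (0 : ℝ) 1 :=
    (ae_restrict_mem measurableSet_Ioo).mono fun _ h => Set.Ioo_subset_Icc_self h
  have h := (hasSum_eulerTransform (integrableOn_betaWeight ha hc) measurable_id measurable_id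
    hm hm b₁ b₂ hp).mul_left (Complex.betaIntegral a (c - a))⁻¹
  convert! h using 1
  funext n
  simp only [id, ← pow_add]
  rw [setIntegral_betaWeight_mul_pow ha hc, add_sub_cancel]
  have := betaIntegral_ne_zero ha hc
  field_simp

theorem isAnalyticContinuation_appellF1 (ha : 0 < a.re) (hc : 0 < (c - a).re) :
    IsAnalyticContinuation (appellF1Series a b₁ b₂ c) appellF1Disc appellF1Domain
      (fun p => (Complex.betaIntegral a (c - a))⁻¹ *
        eulerTransform (volume.restrict (Set.Ioo 0 1)) (betaWeight a (c - a)) id id b₁ b₂ p) := by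
  have hm : ∀ᵐ t ∂(volume.restrict (Set.Ioo (0 : ℝ) 1)), id t ∈ Set.Icc (0 : ℝ) 1 :=
    (ae_restrict_mem measurableSet_Ioo).mono fun _ h => Set.Ioo_subset_Icc_self h
  refine ⟨(differentiableOn_eulerTransform (integrableOn_betaWeight ha hc) measurable_id
    measurable_id hm hm b₁ b₂).const_mul _, fun p hp => ?_⟩
  exact (hasSum_appellF1 ha hc hp).tsum_eq.symm

theorem appellF1_eq_eulerTransform (ha : 0 < a.re) (hc : 0 < (c - a).re) {x z : ℂ}
    (h : (x, z) ∈ appellF1Domain) :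
    appellF1 a b₁ b₂ c x z = (Complex.betaIntegral a (c - a))⁻¹ *
      eulerTransform (volume.restrict (Set.Ioo 0 1)) (betaWeight a (c - a)) id id b₁ b₂ (x, z) :=
  (isAnalyticContinuation_appellF1 ha hc).eqOn isOpen_appellF1Domain zero_mem_appellF1Domain
    appellF1Disc_mem_nhds starConvex_appellF1Domain h

end AppellF1

/-! ### Double Euler integral of Olsson's function -/

/-- The weight of the double Euler integral of Olsson's function, in the variables `(t, s)`. -/
noncomputable def olssonWeight (a b₂ c₁ c₂ : ℂ) (q : ℝ × ℝ) : ℂ :=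
  betaWeight a (b₂ - c₂ + 1) q.1 * betaWeight (a - c₂ + 1) (c₁ + c₂ - a - 1) q.2

/-- The double Euler integral of Olsson's function, normalised to the value `1` at `(0, 1)`. -/
noncomputable def olssonIntegral (a b₁ b₂ c₁ c₂ : ℂ) (p : ℂ × ℂ) : ℂ :=
  (Complex.betaIntegral a (b₂ - c₂ + 1) * Complex.betaIntegral (a - c₂ + 1) (c₁ + c₂ - a - 1))⁻¹ *
    eulerTransform ((volume.restrict (Set.Ioo 0 1)).prod (volume.restrict (Set.Ioo 0 1)))
      (olssonWeight a b₂ c₁ c₂) (fun q => q.1 * q.2) Prod.fst b₁ b₂ (p.1, 1 - p.2)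

section OlssonFP

variable {a b₁ b₂ c₁ c₂ : ℂ}

theorem ae_mem_unitSquare : ∀ᵐ q : ℝ × ℝ ∂((volume.restrict (Set.Ioo (0 : ℝ) 1)).prod
    (volume.restrict (Set.Ioo (0 : ℝ) 1))), q ∈ Set.Ioo (0 : ℝ) 1 ×ˢ Set.Ioo (0 : ℝ) 1 := by
  rw [Measure.prod_restrict]
  exact ae_restrict_mem (measurableSet_Ioo.prod measurableSet_Ioo)

theorem ae_mul_mem_Icc : ∀ᵐ q : ℝ × ℝ ∂((volume.restrict (Set.Ioo (0 : ℝ) 1)).prod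
    (volume.restrict (Set.Ioo (0 : ℝ) 1))), q.1 * q.2 ∈ Set.Icc (0 : ℝ) 1 :=
  ae_mem_unitSquare.mono fun _ h => ⟨mul_nonneg h.1.1.le h.2.1.le,
    mul_le_one₀ h.1.2.le h.2.1.le h.2.2.le⟩

theorem ae_fst_mem_Icc : ∀ᵐ q : ℝ × ℝ ∂((volume.restrict (Set.Ioo (0 : ℝ) 1)).prod
    (volume.restrict (Set.Ioo (0 : ℝ) 1))), q.1 ∈ Set.Icc (0 : ℝ) 1 :=
  ae_mem_unitSquare.mono fun _ h => Set.Ioo_subset_Icc_self h.1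

theorem integrable_olssonWeight (ha : 0 < a.re) (hac : 0 < (a - c₂ + 1).re)
    (h₄ : 0 < (b₂ - c₂ + 1).re) (h₅ : 0 < (c₁ + c₂ - a - 1).re) :
    Integrable (olssonWeight a b₂ c₁ c₂)
      ((volume.restrict (Set.Ioo 0 1)).prod (volume.restrict (Set.Ioo 0 1))) :=
  (integrableOn_betaWeight ha h₄).mul_prod (integrableOn_betaWeight hac h₅)

theorem hasSum_olssonFP (ha : 0 < a.re) (hac : 0 < (a - c₂ + 1).re)
    (h₄ : 0 < (b₂ - c₂ + 1).re) (h₅ : 0 < (c₁ + c₂ - a - 1).re) {p : ℂ × ℂ}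
    (hp : p ∈ olssonFPDisc) :
    HasSum (fun n : ℕ × ℕ =>
      poch a (n.1 + n.2) * poch (a - c₂ + 1) n.1 * poch b₁ n.1 * poch b₂ n.2 /
        (poch (a + b₂ - c₂ + 1) (n.1 + n.2) * poch c₁ n.1 *
          (n.1.factorial : ℂ) * (n.2.factorial : ℂ)) *
        p.1 ^ n.1 * (1 - p.2) ^ n.2) (olssonIntegral a b₁ b₂ c₁ c₂ p) := by
  rw [olssonFPDisc_eq_preimage] at hp
  have h := (hasSum_eulerTransform (integrable_olssonWeight ha hac h₄ h₅)
    (by fun_prop : Measurable fun q : ℝ × ℝ => q.1 * q.2) measurable_fst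
    ae_mul_mem_Icc ae_fst_mem_Icc b₁ b₂ hp).mul_left
    (Complex.betaIntegral a (b₂ - c₂ + 1) *
      Complex.betaIntegral (a - c₂ + 1) (c₁ + c₂ - a - 1))⁻¹
  convert! h using 1
  funext n
  simp only
  -- The moment of (ts)^i t^j splits into t^(i+j) and s^i, which accounts for the factors indexed by
  -- i+j and for (a-c₂+1)_i / (c₁)_i.
  have hmom : ∫ q : ℝ × ℝ, olssonWeight a b₂ c₁ c₂ q *
        (((q.1 * q.2 : ℝ) : ℂ) ^ n.1 * (q.1 : ℂ) ^ n.2)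
      ∂((volume.restrict (Set.Ioo 0 1)).prod (volume.restrict (Set.Ioo 0 1))) =
      (∫ t in Set.Ioo (0 : ℝ) 1, betaWeight a (b₂ - c₂ + 1) t * (t : ℂ) ^ (n.1 + n.2)) *
        ∫ s in Set.Ioo (0 : ℝ) 1, betaWeight (a - c₂ + 1) (c₁ + c₂ - a - 1) s * (s : ℂ) ^ n.1 := by
    rw [← integral_prod_mul]
    congr 1
    funext q
    simp only [olssonWeight]
    push_cast
    ring
  rw [hmom, setIntegral_betaWeight_mul_pow ha h₄, setIntegral_betaWeight_mul_pow hac h₅,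
    show a + (b₂ - c₂ + 1) = a + b₂ - c₂ + 1 by ring,
    show a - c₂ + 1 + (c₁ + c₂ - a - 1) = c₁ by ring]
  have := betaIntegral_ne_zero ha h₄
  have := betaIntegral_ne_zero hac h₅
  field_simp

theorem isAnalyticContinuation_olssonFP (ha : 0 < a.re) (hac : 0 < (a - c₂ + 1).re)
    (h₄ : 0 < (b₂ - c₂ + 1).re) (h₅ : 0 < (c₁ + c₂ - a - 1).re) :
    IsAnalyticContinuation (olssonFPSeries a b₁ b₂ c₁ c₂) olssonFPDisc olssonFPDomain
      (olssonIntegral a b₁ b₂ c₁ c₂) := by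
  refine ⟨?_, fun p hp => (hasSum_olssonFP ha hac h₄ h₅ hp).tsum_eq.symm⟩
  have h := differentiableOn_eulerTransform (integrable_olssonWeight ha hac h₄ h₅)
    (by fun_prop : Measurable fun q : ℝ × ℝ => q.1 * q.2) measurable_fst
    ae_mul_mem_Icc ae_fst_mem_Icc b₁ b₂
  rw [olssonFPDomain_eq_preimage]
  refine DifferentiableOn.const_mul (h.comp (f := fun p : ℂ × ℂ => (p.1, 1 - p.2)) ?_
    (Set.mapsTo_preimage _ _)) _
  fun_prop

theorem olssonFP_eq_olssonIntegral (ha : 0 < a.re) (hac : 0 < (a - c₂ + 1).re)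
    (h₄ : 0 < (b₂ - c₂ + 1).re) (h₅ : 0 < (c₁ + c₂ - a - 1).re) {x y : ℂ}
    (h : (x, y) ∈ olssonFPDomain) :
    olssonFP a b₁ b₂ c₁ c₂ x y = olssonIntegral a b₁ b₂ c₁ c₂ (x, y) :=
  (isAnalyticContinuation_olssonFP ha hac h₄ h₅).eqOn isOpen_olssonFPDomain mem_olssonFPDomain
    olssonFPDisc_mem_nhds starConvex_olssonFPDomain h

end OlssonFP

/-! ### Change of variables on the unit square -/

theorem cpow_ofReal_pos {r : ℝ} (hr : 0 < r) (c : ℂ) :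
    (r : ℂ) ^ c = Complex.exp (Real.log r * c) := by
  rw [Complex.cpow_def_of_ne_zero (by exact_mod_cast hr.ne'), Complex.ofReal_log hr.le]

theorem cpow_ofReal_pos_mul {r : ℝ} (hr : 0 < r) {z : ℂ} (hz : z ≠ 0) (c : ℂ) :
    ((r : ℂ) * z) ^ c = Complex.exp (Real.log r * c) * z ^ c := by
  rw [Complex.cpow_def_of_ne_zero (mul_ne_zero (by exact_mod_cast hr.ne') hz),
    Complex.log_ofReal_mul hr hz, Complex.cpow_def_of_ne_zero hz, ← Complex.exp_add, add_mul]

/-- The substitution `(t, s) ↦ (u, v)` of the unit square with `u = t s` and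
`1 - s = (1 - u) (1 - v)`. -/
noncomputable def olssonSubst (q : ℝ × ℝ) : ℝ × ℝ :=
  (q.1 * q.2, q.2 * (1 - q.1) / (1 - q.1 * q.2))

/-- The derivative of `olssonSubst`. -/
noncomputable def fderivOlssonSubst (q : ℝ × ℝ) : ℝ × ℝ →L[ℝ] ℝ × ℝ :=
  (Matrix.toLin (.finTwoProd ℝ) (.finTwoProd ℝ)
    !![q.2, q.1; -(q.2 * (1 - q.2)) / (1 - q.1 * q.2) ^ 2,
      (1 - q.1) / (1 - q.1 * q.2) ^ 2]).toContinuousLinearMap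

theorem one_sub_mul_pos {q : ℝ × ℝ} (hq : q ∈ Set.Ioo (0 : ℝ) 1 ×ˢ Set.Ioo (0 : ℝ) 1) :
    0 < 1 - q.1 * q.2 :=
  sub_pos.2 (mul_lt_one_of_nonneg_of_lt_one_left hq.1.1.le hq.1.2 hq.2.2.le)

theorem hasFDerivAt_olssonSubst {q : ℝ × ℝ} (hq : 1 - q.1 * q.2 ≠ 0) :
    HasFDerivAt olssonSubst (fderivOlssonSubst q) q := by
  unfold fderivOlssonSubst
  rw [Matrix.toLin_finTwoProd_toContinuousLinearMap]
  have h1 : HasFDerivAt (fun q : ℝ × ℝ => q.1 * q.2) _ q :=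
    (hasFDerivAt_fst (𝕜 := ℝ) (p := q)).mul (hasFDerivAt_snd (𝕜 := ℝ) (p := q))
  have h2 : HasFDerivAt (fun q : ℝ × ℝ => q.2 * (1 - q.1)) _ q :=
    (hasFDerivAt_snd (𝕜 := ℝ) (p := q)).mul ((hasFDerivAt_fst (𝕜 := ℝ) (p := q)).const_sub 1)
  have h3 := h2.mul ((hasDerivAt_inv hq).comp_hasFDerivAt q (h1.const_sub 1))
  convert! h1.prodMk h3 using 1
  ext <;> simp <;> field_simp <;> ring

theorem det_fderivOlssonSubst {q : ℝ × ℝ} (hq : 1 - q.1 * q.2 ≠ 0) :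
    (fderivOlssonSubst q).det = q.2 / (1 - q.1 * q.2) := by
  unfold fderivOlssonSubst
  simp only [LinearMap.det_toContinuousLinearMap, LinearMap.det_toLin, Matrix.det_fin_two_of]
  rw [← mul_div_mul_right q.2 _ hq, ← pow_two]
  ring

theorem bijOn_olssonSubst : Set.BijOn olssonSubst (Set.Ioo (0 : ℝ) 1 ×ˢ Set.Ioo (0 : ℝ) 1)
    (Set.Ioo (0 : ℝ) 1 ×ˢ Set.Ioo (0 : ℝ) 1) := by
  -- Solving for the inverse: s = 1 - (1-u)(1-v) = u + v - uv and t = u / s.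
  refine Set.InvOn.bijOn (f' := fun p => (p.1 / (p.1 + p.2 - p.1 * p.2), p.1 + p.2 - p.1 * p.2))
    ⟨?_, ?_⟩ ?_ ?_
  · rintro ⟨t, s⟩ h
    have hD := one_sub_mul_pos h
    obtain ⟨⟨ht0, ht1⟩, hs0, hs1⟩ := h
    simp only at hD ht0 ht1 hs0 hs1
    have hs : t * s + s * (1 - t) / (1 - t * s) - t * s * (s * (1 - t) / (1 - t * s)) = s := by
      field_simp
      ring
    simp only [olssonSubst, hs, Prod.mk.injEq, and_true]
    field_simp
  · rintro ⟨u, v⟩ ⟨⟨hu0, hu1⟩, hv0, hv1⟩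
    simp only at hu0 hu1 hv0 hv1
    have hS : 0 < u + v - u * v := by nlinarith
    have hD : 1 - u ≠ 0 := by linarith
    have hu : u / (u + v - u * v) * (u + v - u * v) = u := div_mul_cancel₀ _ hS.ne'
    simp only [olssonSubst, hu, Prod.mk.injEq, true_and]
    rw [mul_sub, mul_comm (u + v - u * v) (u / _), hu]
    field_simp
    ring
  · rintro ⟨t, s⟩ h
    have hD := one_sub_mul_pos h
    obtain ⟨⟨ht0, ht1⟩, hs0, hs1⟩ := h
    simp only at hD ht0 ht1 hs0 hs1
    refine ⟨⟨mul_pos ht0 hs0, sub_pos.1 hD⟩, div_pos (mul_pos hs0 (by linarith)) hD, ?_⟩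
    simp only [olssonSubst]
    rw [div_lt_one hD]
    linarith
  · rintro ⟨u, v⟩ ⟨⟨hu0, hu1⟩, hv0, hv1⟩
    simp only at hu0 hu1 hv0 hv1
    have hS : 0 < u + v - u * v := by nlinarith
    refine ⟨⟨div_pos hu0 hS, ?_⟩, hS, ?_⟩
    · simp only
      rw [div_lt_one hS]
      nlinarith
    · simp only
      nlinarith

/-- The integrand of the double integral obtained from the Euler integral of Appell's function. -/
noncomputable def appellIntegrand (a b₁ b₂ c₁ c₂ x y : ℂ) (p : ℝ × ℝ) : ℂ :=
  (p.2 : ℂ) ^ (-c₂) * (1 - (p.2 : ℂ)) ^ (c₁ + c₂ - a - 2) *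
    (betaWeight a (b₂ + c₁ - a) p.1 *
      ((1 - (p.1 : ℂ) * x) ^ (-b₁) * (1 - (p.1 : ℂ) * (((p.2 : ℂ) - y) / p.2)) ^ (-b₂)))

/-- Here 1-u = 1-ts, 1-v = (1-s)/(1-ts), and 1 - u(v-y)/v = (1-ts)/(1-t) · (1-t(1-y)). With the
Jacobian s/(1-ts), the exponents of 1-ts add up to 0. -/
theorem appellIntegrand_olssonSubst {a b₁ b₂ c₁ c₂ x y : ℂ} (hy : y ∈ Complex.slitPlane)
    {q : ℝ × ℝ} (hq : q ∈ Set.Ioo (0 : ℝ) 1 ×ˢ Set.Ioo (0 : ℝ) 1) :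
    |(fderivOlssonSubst q).det| • appellIntegrand a b₁ b₂ c₁ c₂ x y (olssonSubst q) =
      olssonWeight a b₂ c₁ c₂ q *
        ((1 - ((q.1 * q.2 : ℝ) : ℂ) * x) ^ (-b₁) * (1 - (q.1 : ℂ) * (1 - y)) ^ (-b₂)) := by
  have hD := one_sub_mul_pos hq
  have hK : 1 - (q.1 : ℂ) * (1 - y) ≠ 0 := Complex.slitPlane_ne_zero
    (one_sub_ofReal_mul_mem_slitPlane (Set.Ioo_subset_Icc_self hq.1) (by simpa using hy))
  rw [det_fderivOlssonSubst hD.ne', abs_of_pos (div_pos hq.2.1 hD)]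
  obtain ⟨t, s⟩ := q
  obtain ⟨⟨ht0, ht1⟩, hs0, hs1⟩ := hq
  simp only at hD ht0 ht1 hs0 hs1 hK
  have ht1' : 0 < 1 - t := by linarith
  have hs1' : 0 < 1 - s := by linarith
  have hDc : (1 : ℂ) - t * s ≠ 0 := by exact_mod_cast hD.ne'
  have htc : (1 : ℂ) - t ≠ 0 := by exact_mod_cast ht1'.ne'
  have hsc : (s : ℂ) ≠ 0 := by exact_mod_cast hs0.ne'
  have e1 : (1 : ℂ) - ((s * (1 - t) / (1 - t * s) : ℝ) : ℂ) = ((1 - s) / (1 - t * s) : ℝ) := by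
    push_cast
    rw [eq_div_iff hDc, sub_mul, div_mul_cancel₀ _ hDc]
    ring
  have e2 : (1 : ℂ) - ((t * s : ℝ) : ℂ) * ((((s * (1 - t) / (1 - t * s) : ℝ) : ℂ) - y) /
      ((s * (1 - t) / (1 - t * s) : ℝ) : ℂ)) =
      ((1 - t * s) / (1 - t) : ℝ) * (1 - (t : ℂ) * (1 - y)) := by
    push_cast
    field_simp
    ring
  have e3 : ∀ r : ℝ, (1 : ℂ) - r = (1 - r : ℝ) := fun r => by push_cast; rfl
  -- Puts the Jacobian factor in the same exponential form as the powers.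
  have e4 : ∀ r : ℝ, 0 < r → (r : ℂ) = Complex.exp (Real.log r * 1) := fun r hr => by
    rw [mul_one, ← Complex.ofReal_exp, Real.exp_log hr]
  simp only [appellIntegrand, olssonSubst, olssonWeight, betaWeight, Complex.real_smul]
  rw [e1, e2, cpow_ofReal_pos_mul (div_pos hD ht1') hK, e3 (t * s), e3 t, e3 s,
    e4 _ (div_pos hs0 hD), cpow_ofReal_pos (div_pos (mul_pos hs0 ht1') hD),
    cpow_ofReal_pos (div_pos hs1' hD), cpow_ofReal_pos (mul_pos ht0 hs0), cpow_ofReal_pos hD,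
    cpow_ofReal_pos ht0, cpow_ofReal_pos ht1', cpow_ofReal_pos hs0, cpow_ofReal_pos hs1',
    Real.log_div hs0.ne' hD.ne', Real.log_div (mul_pos hs0 ht1').ne' hD.ne',
    Real.log_mul hs0.ne' ht1'.ne', Real.log_div hs1'.ne' hD.ne', Real.log_mul ht0.ne' hs0.ne',
    Real.log_div hD.ne' ht1'.ne']
  push_cast
  generalize (1 - (t : ℂ) * (1 - y)) ^ (-b₂) = K
  generalize (1 - (t : ℂ) * s * x) ^ (-b₁) = L
  -- Once every positive real base is an exponential of its logarithm, only a linear identity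
  -- between the exponents remains.
  have key : ∀ A B C D E F G H M N P : ℂ, A + (B + C) + (D + E) + F = G + H + (M + N) →
      Complex.exp A * (Complex.exp B * Complex.exp C * (Complex.exp D * Complex.exp E *
        (L * (Complex.exp F * K)))) =
      Complex.exp G * Complex.exp H * (Complex.exp M * Complex.exp N) * (L * K) := by
    intro A B C D E F G H M N P h
    rw [← Complex.exp_add G, ← Complex.exp_add M, ← Complex.exp_add (G + H), ← h]
    simp only [Complex.exp_add]
    ring
  refine key _ _ _ _ _ _ _ _ _ _ 0 ?_
  ring

theorem integral_appellIntegrand {a b₁ b₂ c₁ c₂ x y : ℂ} (hy : y ∈ Complex.slitPlane) :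
    ∫ p, appellIntegrand a b₁ b₂ c₁ c₂ x y p
        ∂((volume.restrict (Set.Ioo 0 1)).prod (volume.restrict (Set.Ioo 0 1))) =
      eulerTransform ((volume.restrict (Set.Ioo 0 1)).prod (volume.restrict (Set.Ioo 0 1)))
        (olssonWeight a b₂ c₁ c₂) (fun q => q.1 * q.2) Prod.fst b₁ b₂ (x, 1 - y) := by
  have hS : MeasurableSet (Set.Ioo (0 : ℝ) 1 ×ˢ Set.Ioo (0 : ℝ) 1) :=
    measurableSet_Ioo.prod measurableSet_Ioo
  rw [eulerTransform, Measure.prod_restrict, ← Measure.volume_eq_prod]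
  conv_lhs => rw [← bijOn_olssonSubst.image_eq]
  rw [integral_image_eq_integral_abs_det_fderiv_smul volume hS
    (fun q hq => (hasFDerivAt_olssonSubst (one_sub_mul_pos hq).ne').hasFDerivWithinAt)
    bijOn_olssonSubst.injOn]
  exact setIntegral_congr_fun hS fun q hq => appellIntegrand_olssonSubst hy hq

/-- Integrability is pulled back through the substitution from the Olsson kernel, where the second
kernel factor is bounded; here its argument (v-y)/v can blow up as v → 0. -/
theorem integrable_appellIntegrand {a b₁ b₂ c₁ c₂ x y : ℂ} (ha : 0 < a.re)
    (hac : 0 < (a - c₂ + 1).re) (h₄ : 0 < (b₂ - c₂ + 1).re) (h₅ : 0 < (c₁ + c₂ - a - 1).re)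
    (hx : 1 - x ∈ Complex.slitPlane) (hy : y ∈ Complex.slitPlane) :
    Integrable (appellIntegrand a b₁ b₂ c₁ c₂ x y)
      ((volume.restrict (Set.Ioo 0 1)).prod (volume.restrict (Set.Ioo 0 1))) := by
  have hS : MeasurableSet (Set.Ioo (0 : ℝ) 1 ×ˢ Set.Ioo (0 : ℝ) 1) :=
    measurableSet_Ioo.prod measurableSet_Ioo
  have h := integrable_eulerKernel (integrable_olssonWeight ha hac h₄ h₅)
    (by fun_prop : Measurable fun q : ℝ × ℝ => q.1 * q.2) measurable_fst
    ae_mul_mem_Icc ae_fst_mem_Icc b₁ b₂ (p := (x, 1 - y)) ⟨hx, by simpa using hy⟩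
  rw [Measure.prod_restrict, ← Measure.volume_eq_prod] at h ⊢
  have := (integrableOn_image_iff_integrableOn_abs_det_fderiv_smul volume hS
    (fun q hq => (hasFDerivAt_olssonSubst (one_sub_mul_pos hq).ne').hasFDerivWithinAt)
    bijOn_olssonSubst.injOn (appellIntegrand a b₁ b₂ c₁ c₂ x y)).2
    (IntegrableOn.congr_fun h (fun q hq => (appellIntegrand_olssonSubst hy hq).symm) hS)
  rwa [bijOn_olssonSubst.image_eq] at this

theorem cpow_mul_appellF1_eq {a b₁ b₂ c₁ c₂ x y : ℂ} (ha : 0 < a.re)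
    (h₃ : 0 < (b₂ + c₁ - a).re) (hx : 1 - x ∈ Complex.slitPlane) (hy : y ∈ Complex.slitPlane)
    {v : ℝ} (hv : 0 < v) :
    (v : ℂ) ^ (-c₂) * (1 - (v : ℂ)) ^ (c₁ + c₂ - a - 2) *
        appellF1 a b₁ b₂ (b₂ + c₁) x (((v : ℂ) - y) / v) =
      (Complex.betaIntegral a (b₂ + c₁ - a))⁻¹ *
        ∫ u in Set.Ioo (0 : ℝ) 1, appellIntegrand a b₁ b₂ c₁ c₂ x y (u, v) := by
  have hvc : (v : ℂ) ≠ 0 := by exact_mod_cast hv.ne'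
  -- 1 - (v-y)/v = y/v is a positive multiple of y.
  have hz : 1 - ((v : ℂ) - y) / v ∈ Complex.slitPlane := by
    have : 1 - ((v : ℂ) - y) / v = ((v⁻¹ : ℝ) : ℂ) * y := by
      push_cast
      field_simp
      ring
    rw [this, Complex.mem_slitPlane_iff] at *
    simp only [Complex.re_ofReal_mul, Complex.im_ofReal_mul]
    rcases hy with h | h
    · exact Or.inl (mul_pos (inv_pos.2 hv) h)
    · exact Or.inr (mul_ne_zero (inv_pos.2 hv).ne' h)
  rw [appellF1_eq_eulerTransform ha h₃ ⟨hx, hz⟩, eulerTransform]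
  simp only [appellIntegrand, integral_const_mul, id]
  ring

theorem mem_slitPlane_of_forall_ne {y : ℂ} (hy : ∀ t : ℝ, t ≤ 0 → y ≠ t) :
    y ∈ Complex.slitPlane := by
  rw [Complex.mem_slitPlane_iff]
  by_contra! h
  exact hy y.re h.1 (Complex.ext (by simp) (by simpa using h.2))

/-! ### Assembly of the theorem -/

/-- Integral representation of Olsson's `F_P` by Appell's `F₁`. The first four conjuncts say that
the two double series converge absolutely and that their analytic continuations exist, the fifth
one that the integral converges absolutely. -/
theorem mainTheorem6 (a b₁ b₂ c₁ c₂ : ℂ)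
    (h₁ : 0 < a.re) (h₂ : 0 < (a - b₂).re) (h₃ : 0 < (b₂ + c₁ - a).re)
    (h₄ : 0 < (b₂ - c₂ + 1).re) (h₅ : 0 < (c₁ + c₂ - a - 1).re) :
    (∀ p ∈ olssonFPDisc, Summable fun n : ℕ × ℕ =>
      poch a (n.1 + n.2) * poch (a - c₂ + 1) n.1 * poch b₁ n.1 * poch b₂ n.2 /
        (poch (a + b₂ - c₂ + 1) (n.1 + n.2) * poch c₁ n.1 *
          (n.1.factorial : ℂ) * (n.2.factorial : ℂ)) *
        p.1 ^ n.1 * (1 - p.2) ^ n.2) ∧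
    (∀ p ∈ appellF1Disc, Summable fun n : ℕ × ℕ =>
      poch a (n.1 + n.2) * poch b₁ n.1 * poch b₂ n.2 /
        (poch (b₂ + c₁) (n.1 + n.2) * (n.1.factorial : ℂ) * (n.2.factorial : ℂ)) *
        p.1 ^ n.1 * p.2 ^ n.2) ∧
    IsAnalyticContinuation (olssonFPSeries a b₁ b₂ c₁ c₂) olssonFPDisc olssonFPDomain
      (fun p => olssonFP a b₁ b₂ c₁ c₂ p.1 p.2) ∧
    IsAnalyticContinuation (appellF1Series a b₁ b₂ (b₂ + c₁)) appellF1Disc appellF1Domain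
      (fun p => appellF1 a b₁ b₂ (b₂ + c₁) p.1 p.2) ∧
    ∀ x y : ℂ, (∀ t : ℝ, 1 ≤ t → x ≠ t) → (∀ t : ℝ, t ≤ 0 → y ≠ t) →
      IntervalIntegrable (fun v : ℝ => (v : ℂ) ^ (-c₂) * (1 - (v : ℂ)) ^ (c₁ + c₂ - a - 2) *
        appellF1 a b₁ b₂ (b₂ + c₁) x (((v : ℂ) - y) / v)) MeasureTheory.volume 0 1 ∧
      olssonFP a b₁ b₂ c₁ c₂ x y =
        Complex.Gamma (a + b₂ - c₂ + 1) * Complex.Gamma c₁ * Complex.Gamma (b₂ + c₁ - a) /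
          (Complex.Gamma (b₂ + c₁) * Complex.Gamma (a - c₂ + 1) *
            Complex.Gamma (b₂ - c₂ + 1) * Complex.Gamma (c₁ + c₂ - a - 1)) *
        ∫ v in (0 : ℝ)..1, (v : ℂ) ^ (-c₂) * (1 - (v : ℂ)) ^ (c₁ + c₂ - a - 2) *
          appellF1 a b₁ b₂ (b₂ + c₁) x (((v : ℂ) - y) / v) := by
  -- a - c₂ + 1 = (a - b₂) + (b₂ - c₂ + 1); this is where Re(a - b₂) > 0 enters, making the weight
  -- in s integrable at 0.
  have hac : 0 < (a - c₂ + 1).re := by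
    simp only [Complex.sub_re, Complex.add_re, Complex.one_re] at h₂ h₄ ⊢
    linarith
  refine ⟨fun p hp => (hasSum_olssonFP h₁ hac h₄ h₅ hp).summable,
    fun p hp => (hasSum_appellF1 h₁ h₃ hp).summable,
    analyticContinuation_spec (isAnalyticContinuation_olssonFP h₁ hac h₄ h₅),
    analyticContinuation_spec (isAnalyticContinuation_appellF1 h₁ h₃), fun x y hx hy => ?_⟩
  have hy' := mem_slitPlane_of_forall_ne hy
  have hx' : 1 - x ∈ Complex.slitPlane := mem_slitPlane_of_forall_ne fun t ht h =>
    hx (1 - t) (by linarith) (by push_cast; rw [← h]; ring)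
  have hint := integrable_appellIntegrand (b₁ := b₁) h₁ hac h₄ h₅ hx' hy'
  have hcongr : Set.EqOn (fun v : ℝ => (v : ℂ) ^ (-c₂) * (1 - (v : ℂ)) ^ (c₁ + c₂ - a - 2) *
        appellF1 a b₁ b₂ (b₂ + c₁) x (((v : ℂ) - y) / v))
      (fun v => (Complex.betaIntegral a (b₂ + c₁ - a))⁻¹ *
        ∫ u in Set.Ioo (0 : ℝ) 1, appellIntegrand a b₁ b₂ c₁ c₂ x y (u, v)) (Set.Ioo 0 1) :=
    fun v hv => cpow_mul_appellF1_eq h₁ h₃ hx' hy' hv.1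
  constructor
  · rw [intervalIntegrable_iff_integrableOn_Ioo_of_le zero_le_one]
    exact IntegrableOn.congr_fun (hint.integral_prod_right.const_mul _) hcongr.symm
      measurableSet_Ioo
  · rw [olssonFP_eq_olssonIntegral h₁ hac h₄ h₅ ⟨hx', hy'⟩, olssonIntegral,
      ← integral_appellIntegrand hy', intervalIntegral.integral_of_le zero_le_one,
      integral_Ioc_eq_integral_Ioo, setIntegral_congr_fun measurableSet_Ioo hcongr,
      integral_const_mul, ← integral_prod_symm _ hint, ← mul_assoc]
    -- The double integrals agree; what remains is that the constant equals B(a, b₂+c₁-a) / (B(a,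
    -- b₂-c₂+1) B(a-c₂+1, c₁+c₂-a-1)), in which Γ(a) cancels.
    congr 1
    rw [betaIntegral_eq_Gamma_mul_div h₁ h₄, betaIntegral_eq_Gamma_mul_div hac h₅,
      betaIntegral_eq_Gamma_mul_div h₁ h₃, show a + (b₂ - c₂ + 1) = a + b₂ - c₂ + 1 by ring,
      show a - c₂ + 1 + (c₁ + c₂ - a - 1) = c₁ by ring,
      show a + (b₂ + c₁ - a) = b₂ + c₁ by ring]
    have := Complex.Gamma_ne_zero_of_re_pos h₁
    have := Complex.Gamma_ne_zero_of_re_pos h₃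
    have := Complex.Gamma_ne_zero_of_re_pos h₄
    have := Complex.Gamma_ne_zero_of_re_pos h₅
    have := Complex.Gamma_ne_zero_of_re_pos hac
    have hc : 0 < (b₂ + c₁).re := by
      simp only [Complex.sub_re, Complex.add_re] at h₃ ⊢
      linarith
    have := Complex.Gamma_ne_zero_of_re_pos hc
    field_simp
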